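/- Let $r\ge 2$ and $n\ge 1$ be integers, and let $\mathbb X$ be a set of $2rn$ nodes in which every $x$ has a domain $d_x\in\{1,2\}$ and a class $y_x\in\{1,\dots,r\}$, with exactly $n$ nodes for each pair of a domain and a class. Let $\rho,\alpha,\beta,\gamma\in[0,1]$ satisfy $\rho>\max\{\alpha,\beta\}$ and $\min\{\alpha,\beta\}>\gamma$. Draw a random undirected, unweighted graph $G=(\mathbb X,E)$ from the stochastic block model: independently for all unordered pairs $\{x,x'\}$ (with $x=x'$ allowed), the pair is an edge with probability $\rho$ if $y_x=y_{x'},d_x=d_{x'}$; $\alpha$ if $y_x=y_{x'},d_x\ne d_{x'}$; $\beta$ if $y_x\ne y_{x'},d_x=d_{x'}$; and $\gamma$ if $y_x\ne y_{x'},d_x\neq d_{x'}$. Let $A\in\{0,1\}^{\mathbb X\times\mathbb X}$ be the adjacency matrix of $G$, let $S_+$ be the distribution of positive pairs, $S_+(x,x^+)=A_{xx^+}/\sum_{u,u'}A_{uu'}$, and let $P_U$ be the uniform distribution on $\mathbb X$. Put $k=r+1$, and let the pre-trained encoder $\widehat\phi:\mathbb X\to\mathbb R^{k}$ be a global minimizer,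 over all maps $\phi:\mathbb X\to\mathbb R^k$, of the spectral contrastive loss $$-2\,\mathbb E_{(x,x^+)\sim S_+}\big[\phi(x)^\top\phi(x^+)\big]+\mathbb E_{x,x'\sim P_U}\big[(\phi(x)^\top\phi(x'))^2\big],$$ where $x,x'\sim P_U$ are independent. **Proposition.** There are absolute constants $c,C>0$ and a polynomial $p$ such that for all such $r,n,\rho,\alpha,\beta,\gamma$ with $$n\ \ge\ c\cdot\frac{r}{\min\{\alpha-\gamma,\beta-\gamma\}^2},$$ with probability at least $0.999$ over the random graph the following holds: for every such minimizer $\widehat\phi$ there is a linear classifier $h_{\mathrm{dom}}:\mathbb R^{k}\to\{1,2\}$, that is, $h_{\mathrm{dom}}(z)=\arg\max_{i\in\{1,2\}}(Bz)_i$ for some $B\in\mathbb R^{2\times k}$ (ties being broken in favour of $i=1$), whose domain 0-1 error satisfies $$\Pr_{x\sim P_U}\big[h_{\mathrm{dom}}(\widehat\phi(x))\ne d_x\big]\ \le\ C\cdot\frac{1}{\min\{\alpha-\gamma,\beta-\gamma\}^6\,n}\cdot p(r).$$ -/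

import Mathlib

open MeasureTheory ProbabilityTheory
open scoped RealInnerProductSpace unitInterval

noncomputable section

namespace ContrastiveSBM

/-- The nodes (inputs): there are two domains, `r` classes, and `n` points for every pair of a
domain and a class.  Domain `0` is the source and domain `1` is the target. -/
abbrev Node (r n : ℕ) : Type := Fin 2 × Fin r × Fin n

/-- The domain `d_x` of a node. -/
def dom {r n : ℕ} (x : Node r n) : Fin 2 := x.1

/-- The class `y_x` of a node. -/
def cls {r n : ℕ} (x : Node r n) : Fin r := x.2.1

/-- The probability that the unordered pair `{x, x'}` (where `x = x'` is allowed) is an edge. -/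
def edgeProb {r n : ℕ} (ρ α β γ : I) : Sym2 (Node r n) → I :=
  Sym2.lift ⟨fun x x' =>
      if cls x = cls x' then (if dom x = dom x' then ρ else α)
      else (if dom x = dom x' then β else γ),
    fun x x' => by simp only [eq_comm]⟩

/-- An undirected, unweighted graph on `V`, self-loops allowed, given by the indicator of its
edge set. -/
abbrev Graph (V : Type) : Type := Sym2 V → Bool

/-- The law of the stochastic block model: all edges are sampled independently, the edge `e` being
present with probability `edgeProb ρ α β γ e`. -/
def sbm (r n : ℕ) (ρ α β γ : I) : Measure (Graph (Node r n)) :=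
  Measure.pi fun e => bernoulliMeasure true false (edgeProb ρ α β γ e)

instance (r n : ℕ) (ρ α β γ : I) : IsProbabilityMeasure (sbm r n ρ α β γ) := by
  unfold sbm; infer_instance

variable {V : Type}

/-- The adjacency matrix of a graph. -/
def adj (G : Graph V) : Matrix V V ℝ :=
  Matrix.of fun x x' => if G s(x, x') then 1 else 0

variable [Fintype V]

/-- The spectral contrastive loss of an encoder `φ : V → ℝᵏ`.  Positive pairs are uniform over the
edges of `G`, that is, `(x, x⁺)` has probability `A x x⁺ / ∑ A`; the two members of a negative pair
are independent and uniform over `V`. -/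
def pretrainLoss {k : ℕ} (G : Graph V) (φ : V → EuclideanSpace ℝ (Fin k)) : ℝ :=
  -2 * ∑ x, ∑ x', (adj G x x' / ∑ u, ∑ u', adj G u u') * ⟪φ x, φ x'⟫
    + ∑ x, ∑ x', (1 / (Fintype.card V : ℝ) ^ 2) * ⟪φ x, φ x'⟫ ^ 2

/-- `φ` is an encoder learned by contrastive pre-training on the graph `G`: a global minimizer of
the spectral contrastive loss among all maps `V → ℝᵏ`. -/
def IsPretrained {k : ℕ} (G : Graph V) (φ : V → EuclideanSpace ℝ (Fin k)) : Prop :=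
  ∀ ψ : V → EuclideanSpace ℝ (Fin k), pretrainLoss G φ ≤ pretrainLoss G ψ

/-- Pre-trained encoders exist, for every graph and every feature dimension. -/
theorem exists_isPretrained (k : ℕ) (G : Graph V) :
    ∃ φ : V → EuclideanSpace ℝ (Fin k), IsPretrained G φ := by
  rcases isEmpty_or_nonempty V with hV | hV
  · exact ⟨0, fun ψ => le_of_eq (congrArg _ (Subsingleton.elim _ _))⟩
  have hcont : Continuous fun φ : V → EuclideanSpace ℝ (Fin k) => pretrainLoss G φ := by
    unfold pretrainLoss; fun_prop
  set N : ℝ := (Fintype.card V : ℝ) with hN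
  have hNpos : 0 < N := by rw [hN]; exact_mod_cast Fintype.card_pos
  set q : ℝ := 1 / N ^ 2 with hq
  have hqpos : 0 < q := by positivity
  set w : V → V → ℝ := fun x x' => adj G x x' / ∑ u, ∑ u', adj G u u' with hw
  set c : ℝ := ∑ x, ∑ x', (2 / q) * w x x' ^ 2 with hc
  have key : ∀ φ : V → EuclideanSpace ℝ (Fin k),
      q * ‖φ‖ - (c + N * q) ≤ pretrainLoss G φ := by
    intro φ
    have h1 : pretrainLoss G φ
        = ∑ x, ∑ x', (-2 * (w x x' * ⟪φ x, φ x'⟫) + q * ⟪φ x, φ x'⟫ ^ 2) := by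
      simp only [pretrainLoss, Finset.sum_add_distrib, Finset.mul_sum, hw, hq, hN]
    have h2 : ∑ x, ∑ x', ((q / 2) * ⟪φ x, φ x'⟫ ^ 2 - (2 / q) * w x x' ^ 2)
        ≤ pretrainLoss G φ := by
      rw [h1]
      refine Finset.sum_le_sum fun x _ => Finset.sum_le_sum fun x' _ => ?_
      have : (q / 2) * ⟪φ x, φ x'⟫ ^ 2 - 2 * (w x x' * ⟪φ x, φ x'⟫) + (2 / q) * w x x' ^ 2
          = (q / 2) * (⟪φ x, φ x'⟫ - 2 / q * w x x') ^ 2 := by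
        field_simp; ring
      have h0 : 0 ≤ (q / 2) * (⟪φ x, φ x'⟫ - 2 / q * w x x') ^ 2 := by positivity
      linarith
    have h3 : ∑ x, (q * ‖φ x‖ - q) ≤ ∑ x, ∑ x', (q / 2) * ⟪φ x, φ x'⟫ ^ 2 := by
      refine Finset.sum_le_sum fun x _ => ?_
      refine le_trans ?_ (Finset.single_le_sum (f := fun x' => (q / 2) * ⟪φ x, φ x'⟫ ^ 2)
        (fun x' _ => by positivity) (Finset.mem_univ x))
      simp only [real_inner_self_eq_norm_sq]
      have : 0 ≤ (‖φ x‖ ^ 2 - 1) ^ 2 + 2 * (‖φ x‖ - 1 / 2) ^ 2 + 1 / 2 := by positivity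
      nlinarith
    have h4 : ‖φ‖ ≤ ∑ x, ‖φ x‖ :=
      (pi_norm_le_iff_of_nonneg (Finset.sum_nonneg fun _ _ => norm_nonneg _)).2 fun x =>
        Finset.single_le_sum (f := fun x => ‖φ x‖) (fun _ _ => norm_nonneg _) (Finset.mem_univ x)
    have h5 : ∑ x, (q * ‖φ x‖ - q) = q * ∑ x, ‖φ x‖ - N * q := by
      simp [Finset.sum_sub_distrib, Finset.mul_sum, hN]
    simp only [Finset.sum_sub_distrib] at h2
    have h6 := mul_le_mul_of_nonneg_left h4 hqpos.le
    linarith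
  have hlim : Filter.Tendsto (fun φ : V → EuclideanSpace ℝ (Fin k) => pretrainLoss G φ)
      (Filter.cocompact _) Filter.atTop := by
    refine Filter.tendsto_atTop_mono key ?_
    exact Filter.tendsto_atTop_add_const_right _ _
      ((tendsto_norm_cocompact_atTop).const_mul_atTop hqpos)
  exact hcont.exists_forall_le hlim

/-- The linear two-domain classifier with parameters `B : ℝ^{2 × k}`, which maps `z` to
`argmax_i (B z)_i`, the smaller index being taken in case of a tie. -/
def linearClassifier {k : ℕ} (B : Matrix (Fin 2) (Fin k) ℝ) (z : EuclideanSpace ℝ (Fin k)) :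
    Fin 2 :=
  if (B.mulVec z) 1 ≤ (B.mulVec z) 0 then 0 else 1

/-- A domain classifier on `ℝᵏ` is linear if it is the argmax of linear scores. -/
def IsLinearClassifier {k : ℕ} (h : EuclideanSpace ℝ (Fin k) → Fin 2) : Prop :=
  ∃ B : Matrix (Fin 2) (Fin k) ℝ, h = linearClassifier B

/-- The 0-1 loss for domain classification of `h ∘ φ`, under the uniform distribution over the
nodes of both domains. -/
def domainZeroOneLoss {r n k : ℕ} (h : EuclideanSpace ℝ (Fin k) → Fin 2)
    (φ : Node r n → EuclideanSpace ℝ (Fin k)) : ℝ :=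
  ∑ x : Node r n, (1 / (Fintype.card (Node r n) : ℝ)) * (if h (φ x) ≠ dom x then 1 else 0)

end ContrastiveSBM

end

/-! Up to scale and a constant, the loss is the squared Frobenius distance from `X * Xᵀ` to a
positive multiple of the adjacency matrix `A`, the rows of `X` being the features. The optimality
conditions replace spectral theory: the columns of a minimizer span an `A`-invariant space
(`IsBestFactor.mul_eq`), and a dimension count (`IsBestFactor.rayleigh_le_of_forall`) shows that on
its complement `A` is no larger than on the complement of any `r + 1` chosen vectors.

Choose the `r` class indicators and the sign vector `d` of the domains. The mean of `A` has `d` as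
eigenvector with eigenvalue `μ`, and off the chosen vectors its quadratic form stays below `μ` by `n
* m`, where `m = min (α - γ) (β - γ)`. Let `E` be the noise and `u` the residual of `d` after
projection onto the columns of `X`. Invariance gives `u ⬝ᵥ A *ᵥ d = u ⬝ᵥ A *ᵥ u`, so if the
quadratic form of `E` uses at most half the gap, then `n * m / 2 * |u| ≤ |E *ᵥ d|`. Each
misclassified node contributes at least 1 to `|u|²`. Second and fourth moments of `E` with Markov's
inequality (`edgeLaw_real_noise_small`) control both noise terms. -/

namespace ContrastiveSBM

open Matrix

/-! ### Optimality conditions for factored low-rank approximation -/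

section LowRank

variable {V κ : Type*} [Fintype V] [Fintype κ]

/-- The squared Frobenius norm of a real matrix. -/
def frobSq (M : Matrix V V ℝ) : ℝ := ∑ x, ∑ y, M x y ^ 2

/-- The Frobenius inner product of two real matrices. -/
def frobInner (M N : Matrix V V ℝ) : ℝ := ∑ x, ∑ y, M x y * N x y

theorem frobSq_nonneg (M : Matrix V V ℝ) : 0 ≤ frobSq M :=
  Finset.sum_nonneg fun _ _ => Finset.sum_nonneg fun _ _ => sq_nonneg _

theorem frobSq_add (M N : Matrix V V ℝ) :
    frobSq (M + N) = frobSq M + 2 * frobInner M N + frobSq N := by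
  simp only [frobSq, frobInner, Finset.mul_sum, ← Finset.sum_add_distrib, Matrix.add_apply]
  exact Finset.sum_congr rfl fun _ _ => Finset.sum_congr rfl fun _ _ => by ring

theorem frobSq_smul (t : ℝ) (M : Matrix V V ℝ) : frobSq (t • M) = t ^ 2 * frobSq M := by
  simp [frobSq, Finset.mul_sum, mul_pow]

theorem frobInner_add (M N P : Matrix V V ℝ) :
    frobInner M (N + P) = frobInner M N + frobInner M P := by
  simp [frobInner, mul_add, Finset.sum_add_distrib]

theorem frobInner_smul (t : ℝ) (M N : Matrix V V ℝ) :
    frobInner M (t • N) = t * frobInner M N := by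
  simp [frobInner, Finset.mul_sum, mul_left_comm]

theorem frobInner_eq_trace (M N : Matrix V V ℝ) : frobInner M N = (Mᵀ * N).trace := by
  simp only [frobInner, trace, diag_apply, mul_apply, transpose_apply]
  exact Finset.sum_comm

theorem frobInner_vecMulVec (M : Matrix V V ℝ) (p q : V → ℝ) :
    frobInner M (vecMulVec p q) = p ⬝ᵥ M *ᵥ q := by
  simp only [frobInner, vecMulVec_apply, dotProduct, mulVec, Finset.mul_sum]
  exact Finset.sum_congr rfl fun _ _ => Finset.sum_congr rfl fun _ _ => by ring

theorem frobSq_vecMulVec (p q : V → ℝ) : frobSq (vecMulVec p q) = (p ⬝ᵥ p) * (q ⬝ᵥ q) := by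
  simp only [frobSq, vecMulVec_apply, dotProduct, Finset.sum_mul_sum]
  exact Finset.sum_congr rfl fun _ _ => Finset.sum_congr rfl fun _ _ => by ring

/-- `X` is a global minimizer of the factored low-rank approximation error of `T`. -/
def IsBestFactor (T : Matrix V V ℝ) (X : Matrix V κ ℝ) : Prop :=
  ∀ Y : Matrix V κ ℝ, frobSq (X * Xᵀ - T) ≤ frobSq (Y * Yᵀ - T)

theorem IsBestFactor.nonneg_of_eq {T : Matrix V V ℝ} {X : Matrix V κ ℝ} (hX : IsBestFactor T X)
    (Y : Matrix V κ ℝ) {S : Matrix V V ℝ} (hS : Y * Yᵀ = X * Xᵀ + S) :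
    0 ≤ 2 * frobInner (X * Xᵀ - T) S + frobSq S := by
  have h := hX Y
  rw [hS, show X * Xᵀ + S - T = (X * Xᵀ - T) + S by abel, frobSq_add] at h
  linarith

/-- The polynomial vanishes at 0, so it has a minimum there and its derivative is zero. -/
theorem linear_coeff_eq_zero {a b c d : ℝ}
    (h : ∀ t : ℝ, 0 ≤ t * a + t ^ 2 * b + t ^ 3 * c + t ^ 4 * d) : a = 0 := by
  have hd : HasDerivAt (fun t : ℝ => t * a + t ^ 2 * b + t ^ 3 * c + t ^ 4 * d) a 0 := by
    have := ((((hasDerivAt_id' (0 : ℝ)).mul_const a).add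
      ((hasDerivAt_pow 2 (0 : ℝ)).mul_const b)).add
      ((hasDerivAt_pow 3 (0 : ℝ)).mul_const c)).add
      ((hasDerivAt_pow 4 (0 : ℝ)).mul_const d)
    exact this.congr_deriv (by norm_num)
  refine IsLocalMin.hasDerivAt_eq_zero (Filter.Eventually.of_forall fun t => ?_) hd
  simpa using h t

theorem eq_zero_of_trace_transpose_mul_self {M : Matrix V κ ℝ} (h : (Mᵀ * M).trace = 0) :
    M = 0 := by
  have := (Matrix.trace_conjTranspose_mul_self_eq_zero_iff (A := M)).1 (by simpa using h)
  exact this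

/-- First-order optimality for the factored low-rank approximation problem. -/
theorem IsBestFactor.mul_eq {T : Matrix V V ℝ} (hT : Tᵀ = T) {X : Matrix V κ ℝ}
    (hX : IsBestFactor T X) : X * Xᵀ * X = T * X := by
  set R : Matrix V V ℝ := X * Xᵀ - T with hR
  have hRt : Rᵀ = R := by simp [hR, hT]
  -- `D` is the gradient direction up to a factor; moving along it, the linear coefficient is a
  -- multiple of the squared Frobenius norm of `D`.
  set D : Matrix V κ ℝ := R * X with hD
  set L : Matrix V V ℝ := X * Dᵀ + D * Xᵀ
  set J : Matrix V V ℝ := D * Dᵀ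
  have key : ∀ t : ℝ, 0 ≤ t * (2 * frobInner R L)
      + t ^ 2 * (2 * frobInner R J + frobSq L) + t ^ 3 * (2 * frobInner L J)
      + t ^ 4 * frobSq J := by
    intro t
    have h := hX.nonneg_of_eq (X + t • D) (S := t • (L + t • J)) (by
      simp only [L, J, transpose_add, transpose_smul, Matrix.add_mul, Matrix.mul_add,
        Matrix.smul_mul, Matrix.mul_smul, smul_add]
      abel)
    simp only [frobInner_smul, frobSq_smul, frobInner_add, frobSq_add] at h
    rw [← hR] at h
    linarith
  have h0 := linear_coeff_eq_zero key
  have h1 : frobInner R L = 2 * (Dᵀ * D).trace := by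
    have e1 : (Rᵀ * (X * Dᵀ)).trace = (Dᵀ * D).trace := by
      rw [hRt, ← Matrix.mul_assoc, ← hD, Matrix.trace_mul_comm]
    have e2 : (Rᵀ * (D * Xᵀ)).trace = (Dᵀ * D).trace := by
      rw [← Matrix.trace_transpose, Matrix.transpose_mul, Matrix.transpose_mul,
        Matrix.transpose_transpose, Matrix.transpose_transpose, Matrix.mul_assoc,
        Matrix.trace_mul_comm, Matrix.mul_assoc, ← hD]
    rw [frobInner_add, frobInner_eq_trace, frobInner_eq_trace, e1, e2]; ring
  have h2 : D = 0 := eq_zero_of_trace_transpose_mul_self (by linarith)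
  rw [hD, hR, Matrix.sub_mul, sub_eq_zero] at h2
  exact h2

/-- Second-order optimality: a direction orthogonal to the columns of `X` with positive Rayleigh
quotient bounds the singular values of `X` from below. -/
theorem IsBestFactor.rayleigh_le [DecidableEq κ] {T : Matrix V V ℝ} (hT : Tᵀ = T)
    {X : Matrix V κ ℝ} (hX : IsBestFactor T X) {u : V → ℝ} (hu : u ⬝ᵥ u = 1)
    (hXu : Xᵀ *ᵥ u = 0) {b : κ → ℝ} (hb : b ⬝ᵥ b = 1) :
    u ⬝ᵥ T *ᵥ u ≤ (X *ᵥ b) ⬝ᵥ (X *ᵥ b) := by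
  set τ := u ⬝ᵥ T *ᵥ u with hτ
  set p := X *ᵥ b with hp
  have hpp : 0 ≤ p ⬝ᵥ p := by simpa using dotProduct_star_self_nonneg p
  rcases le_or_gt τ 0 with h0 | h0
  · exact h0.trans hpp
  have hup : u ⬝ᵥ p = 0 := by
    rw [hp, dotProduct_mulVec, ← mulVec_transpose, hXu, zero_dotProduct]
  have hRp : (X * Xᵀ - T) *ᵥ p = 0 := by
    rw [hp, mulVec_mulVec, Matrix.sub_mul, hX.mul_eq hT, sub_self, zero_mulVec]
  have hRu : u ⬝ᵥ (X * Xᵀ - T) *ᵥ u = -τ := by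
    rw [sub_mulVec, ← mulVec_mulVec, hXu, mulVec_zero, zero_sub, dotProduct_neg]
  have hsq : √τ * √τ = τ := Real.mul_self_sqrt h0.le
  -- The competitor trades the image `p` of the direction `b` for `√τ • u`. Since the residual
  -- matrix kills `p` and has value `-τ` at `u`, optimality reduces to `τ ^ 2 ≤ (p ⬝ᵥ p) ^ 2`.
  have hY : (X - vecMulVec p b + √τ • vecMulVec u b) * (X - vecMulVec p b + √τ • vecMulVec u b)ᵀ
      = X * Xᵀ + (τ • vecMulVec u u + (-1 : ℝ) • vecMulVec p p) := by
    have e1 : X * (vecMulVec p b)ᵀ = vecMulVec p p := by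
      rw [transpose_vecMulVec, mul_vecMulVec]
    have e2 : X * (vecMulVec u b)ᵀ = vecMulVec p u := by
      rw [transpose_vecMulVec, mul_vecMulVec]
    have e3 : vecMulVec p b * Xᵀ = vecMulVec p p := by
      rw [vecMulVec_mul, vecMul_transpose]
    have e4 : vecMulVec u b * Xᵀ = vecMulVec u p := by
      rw [vecMulVec_mul, vecMul_transpose]
    have e5 : ∀ q q' : V → ℝ, vecMulVec q b * (vecMulVec q' b)ᵀ = vecMulVec q q' := by
      intro q q'
      rw [transpose_vecMulVec, vecMulVec_mul_vecMulVec, hb, one_smul]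
    simp only [transpose_add, transpose_sub, transpose_smul, Matrix.add_mul, Matrix.sub_mul,
      Matrix.mul_add, Matrix.mul_sub, Matrix.smul_mul, Matrix.mul_smul, e1, e2, e3, e4, e5]
    rw [show τ • vecMulVec u u = √τ • √τ • vecMulVec u u by rw [smul_smul, hsq]]
    module
  have h := hX.nonneg_of_eq _ hY
  have hcross : p ⬝ᵥ (τ • vecMulVec u u) *ᵥ p = 0 := by
    rw [smul_mulVec, vecMulVec_mulVec]
    simp [hup]
  simp only [frobInner_add, frobInner_smul, frobInner_vecMulVec, frobSq_add, frobSq_smul,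
    frobSq_vecMulVec, hcross, hRp, hRu, hu, dotProduct_zero] at h
  exact (pow_le_pow_iff_left₀ h0.le hpp two_ne_zero).1 (by linarith)

theorem IsBestFactor.rayleigh_mul_le [DecidableEq κ] {T : Matrix V V ℝ} (hT : Tᵀ = T)
    {X : Matrix V κ ℝ} (hX : IsBestFactor T X) {u : V → ℝ} (hu : u ⬝ᵥ u = 1)
    (hXu : Xᵀ *ᵥ u = 0) (b : κ → ℝ) :
    (u ⬝ᵥ T *ᵥ u) * (b ⬝ᵥ b) ≤ (X *ᵥ b) ⬝ᵥ (X *ᵥ b) := by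
  have hbb : 0 ≤ b ⬝ᵥ b := by simpa using dotProduct_star_self_nonneg b
  rcases hbb.eq_or_lt with h | h
  · rw [← h, mul_zero]; simpa using dotProduct_star_self_nonneg (X *ᵥ b)
  set s := √(b ⬝ᵥ b)
  have hs : s * s = b ⬝ᵥ b := Real.mul_self_sqrt hbb
  have hs0 : 0 < s := Real.sqrt_pos.2 h
  have h1 := hX.rayleigh_le hT hu hXu (b := s⁻¹ • b) (by
    rw [smul_dotProduct, dotProduct_smul, ← hs, smul_eq_mul, smul_eq_mul]; field_simp)
  rw [mulVec_smul, smul_dotProduct, dotProduct_smul, smul_eq_mul, smul_eq_mul, ← mul_assoc,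
    ← mul_inv, hs, inv_mul_eq_div, le_div_iff₀ h] at h1
  exact h1

/-- On the span of the columns of `X` and of `u`, the quadratic form of `T` dominates the Rayleigh
quotient of `u`. -/
theorem IsBestFactor.rayleigh_le_span [DecidableEq κ] {T : Matrix V V ℝ} (hT : Tᵀ = T)
    {X : Matrix V κ ℝ} (hX : IsBestFactor T X) {u : V → ℝ} (hu : u ⬝ᵥ u = 1)
    (hXu : Xᵀ *ᵥ u = 0) (h0 : 0 ≤ u ⬝ᵥ T *ᵥ u) (b : κ → ℝ) (s : ℝ) :
    (u ⬝ᵥ T *ᵥ u) * ((X *ᵥ b + s • u) ⬝ᵥ (X *ᵥ b + s • u))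
      ≤ (X *ᵥ b + s • u) ⬝ᵥ T *ᵥ (X *ᵥ b + s • u) := by
  set τ := u ⬝ᵥ T *ᵥ u with hτ
  set p := X *ᵥ b with hp
  have hup : u ⬝ᵥ p = 0 := by
    rw [hp, dotProduct_mulVec, ← mulVec_transpose, hXu, zero_dotProduct]
  have hpu : p ⬝ᵥ u = 0 := by rw [dotProduct_comm, hup]
  have hTp : T *ᵥ p = X *ᵥ (Xᵀ *ᵥ p) := by
    rw [hp, mulVec_mulVec, ← hX.mul_eq hT, mulVec_mulVec, mulVec_mulVec, Matrix.mul_assoc]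
  have hX0 : ∀ c, u ⬝ᵥ X *ᵥ c = 0 := by
    intro c; rw [dotProduct_mulVec, ← mulVec_transpose, hXu, zero_dotProduct]
  have huTp : u ⬝ᵥ T *ᵥ p = 0 := by rw [hTp, hX0]
  have hpTu : p ⬝ᵥ T *ᵥ u = 0 := by
    rw [dotProduct_mulVec, ← mulVec_transpose, hT, dotProduct_comm, huTp]
  set q := Xᵀ *ᵥ p with hq
  have hpTp : p ⬝ᵥ T *ᵥ p = q ⬝ᵥ q := by
    rw [hTp, dotProduct_mulVec, ← mulVec_transpose]
  have hbq : b ⬝ᵥ q = p ⬝ᵥ p := by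
    rw [hq, dotProduct_mulVec, vecMul_transpose]
  have h1 := hX.rayleigh_mul_le hT hu hXu b
  rw [← hτ, ← hp] at h1
  have h2 : (b ⬝ᵥ q) ^ 2 ≤ (b ⬝ᵥ b) * (q ⬝ᵥ q) := by
    simp only [dotProduct, ← sq]; exact Finset.sum_mul_sq_le_sq_mul_sq _ _ _
  have hbb : 0 ≤ b ⬝ᵥ b := by simpa using dotProduct_star_self_nonneg b
  have hpp : 0 ≤ p ⬝ᵥ p := by simpa using dotProduct_star_self_nonneg p
  have hqq : 0 ≤ q ⬝ᵥ q := by simpa using dotProduct_star_self_nonneg q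
  -- Cauchy–Schwarz gives `(p ⬝ᵥ p) ^ 2 ≤ (b ⬝ᵥ b) * (q ⬝ᵥ q)`, and the second-order bound gives `τ
  -- * (b ⬝ᵥ b) ≤ p ⬝ᵥ p`.
  have h3 : τ * (p ⬝ᵥ p) ≤ q ⬝ᵥ q := by
    rcases hpp.eq_or_lt with h | h
    · rw [← h, mul_zero]; exact hqq
    · rw [hbq] at h2
      have : τ * (p ⬝ᵥ p) * (p ⬝ᵥ p) ≤ (q ⬝ᵥ q) * (p ⬝ᵥ p) := by
        calc τ * (p ⬝ᵥ p) * (p ⬝ᵥ p) = τ * (p ⬝ᵥ p) ^ 2 := by ring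
          _ ≤ τ * ((b ⬝ᵥ b) * (q ⬝ᵥ q)) := by gcongr
          _ = (q ⬝ᵥ q) * (τ * (b ⬝ᵥ b)) := by ring
          _ ≤ (q ⬝ᵥ q) * (p ⬝ᵥ p) := by gcongr
      exact le_of_mul_le_mul_right this h
  simp only [mulVec_add, mulVec_smul, add_dotProduct, dotProduct_add, smul_dotProduct,
    dotProduct_smul, smul_eq_mul, hup, hpu, huTp, hpTu, hpTp, hu, ← hτ]
  linarith

/-- If `T` is at most `B` on the orthogonal complement of fewer test vectors than the span of the
columns of `X` and one further vector has dimensions, then it is at most `B` on the orthogonal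
complement of the columns of a best factor `X`. -/
theorem IsBestFactor.rayleigh_le_of_forall [DecidableEq κ] {T : Matrix V V ℝ} (hT : Tᵀ = T)
    {X : Matrix V κ ℝ} (hX : IsBestFactor T X) {ι : Type*} [Fintype ι] (w : ι → V → ℝ)
    (hι : Fintype.card ι ≤ Fintype.card κ) {B : ℝ} (hB : 0 ≤ B)
    (h : ∀ v : V → ℝ, (∀ i, w i ⬝ᵥ v = 0) → v ⬝ᵥ T *ᵥ v ≤ B * (v ⬝ᵥ v))
    {u : V → ℝ} (hXu : Xᵀ *ᵥ u = 0) : u ⬝ᵥ T *ᵥ u ≤ B * (u ⬝ᵥ u) := by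
  have unit : ∀ u : V → ℝ, u ⬝ᵥ u = 1 → Xᵀ *ᵥ u = 0 → u ⬝ᵥ T *ᵥ u ≤ B := by
    intro u hu hXu
    by_contra! hlt
    have hτ : 0 < u ⬝ᵥ T *ᵥ u := hB.trans_lt hlt
    -- Courant–Fischer count: the source has one dimension more than `κ`, so some nonzero `(b, s)`
    -- gives a vector orthogonal to all test vectors.
    let f : ((κ → ℝ) × ℝ) →ₗ[ℝ] (ι → ℝ) :=
      (Matrix.of w).mulVecLin ∘ₗ (X.mulVecLin.coprod (LinearMap.toSpanSingleton ℝ (V → ℝ) u))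
    have hker : LinearMap.ker f ≠ ⊥ := f.ker_ne_bot_of_finrank_lt (by simp; omega)
    obtain ⟨⟨b, s⟩, hmem, hne⟩ := (Submodule.ne_bot_iff _).1 hker
    have hv : ∀ i, w i ⬝ᵥ (X *ᵥ b + s • u) = 0 := fun i => congrFun (LinearMap.mem_ker.1 hmem) i
    have h1 := h _ hv
    have h2 := hX.rayleigh_le_span hT hu hXu hτ.le b s
    have h3 := hX.rayleigh_mul_le hT hu hXu b
    have hup : u ⬝ᵥ X *ᵥ b = 0 := by
      rw [dotProduct_mulVec, ← mulVec_transpose, hXu, zero_dotProduct]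
    -- The vector is nonzero because `0 < τ` makes `X` injective by `h3`, while `u` is orthogonal to
    -- its range.
    have hpos : 0 < (X *ᵥ b + s • u) ⬝ᵥ (X *ᵥ b + s • u) := by
      have e : (X *ᵥ b + s • u) ⬝ᵥ (X *ᵥ b + s • u) = (X *ᵥ b) ⬝ᵥ (X *ᵥ b) + s ^ 2 := by
        simp only [add_dotProduct, dotProduct_add, smul_dotProduct, dotProduct_smul, smul_eq_mul,
          hup, dotProduct_comm (X *ᵥ b) u, hu]
        ring
      rw [e]
      have hbb : 0 ≤ b ⬝ᵥ b := by simpa using dotProduct_star_self_nonneg b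
      by_cases hb : b = 0
      · have hs : s ≠ 0 := fun hs => hne (by simp [hb, hs])
        linarith [mul_nonneg hτ.le hbb, sq_pos_of_ne_zero hs]
      · have hb' : 0 < b ⬝ᵥ b := hbb.lt_of_ne fun h => hb (dotProduct_self_eq_zero.1 h.symm)
        have := mul_pos hτ hb'
        nlinarith [sq_nonneg s]
    have := mul_lt_mul_of_pos_right hlt hpos
    linarith
  have huu : 0 ≤ u ⬝ᵥ u := by simpa using dotProduct_star_self_nonneg u
  rcases huu.eq_or_lt with h' | h'
  · rw [dotProduct_self_eq_zero.1 h'.symm]; simp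
  set s := √(u ⬝ᵥ u)
  have hs : s * s = u ⬝ᵥ u := Real.mul_self_sqrt huu
  have hs0 : 0 < s := Real.sqrt_pos.2 h'
  have h1 := unit (s⁻¹ • u) (by
    rw [smul_dotProduct, dotProduct_smul, ← hs, smul_eq_mul, smul_eq_mul]; field_simp)
    (by rw [mulVec_smul, hXu, smul_zero])
  rw [mulVec_smul, smul_dotProduct, dotProduct_smul, smul_eq_mul, smul_eq_mul, ← mul_assoc,
    ← mul_inv, hs, inv_mul_eq_div, div_le_iff₀ h'] at h1
  exact h1

/-- Least squares: every vector has a residual orthogonal to the columns of `X`. -/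
theorem exists_transpose_mulVec_sub_eq_zero (X : Matrix V κ ℝ) (d : V → ℝ) :
    ∃ b, Xᵀ *ᵥ (d - X *ᵥ b) = 0 := by
  let K : Submodule ℝ (EuclideanSpace ℝ V) :=
    (LinearMap.range X.mulVecLin).map (WithLp.linearEquiv 2 ℝ (V → ℝ)).symm.toLinearMap
  obtain ⟨y, hy, z, hz, h⟩ := K.exists_add_mem_mem_orthogonal (WithLp.toLp 2 d)
  obtain ⟨_, ⟨b, rfl⟩, rfl⟩ := hy
  refine ⟨b, ?_⟩
  have hdz : d - X *ᵥ b = z.ofLp := by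
    have := congrArg WithLp.ofLp h
    simp only [WithLp.ofLp_add] at this
    rw [this]
    simp
  rw [hdz]
  refine dotProduct_eq_zero _ fun c => ?_
  have h2 := (Submodule.mem_orthogonal _ _).1 hz _
    (Submodule.mem_map_of_mem (LinearMap.mem_range_self X.mulVecLin c))
  rw [EuclideanSpace.inner_eq_star_dotProduct] at h2
  rw [← vecMul_transpose, transpose_transpose, ← dotProduct_mulVec]
  simpa using h2

end LowRank

/-! ### The contrastive loss as matrix factorization -/

section Loss

variable {V : Type}

theorem adj_transpose (G : Graph V) : (adj G)ᵀ = adj G := by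
  ext x y; simp [adj, Sym2.eq_swap]

variable [Fintype V]

/-- Pre-training is low-rank approximation of the normalized adjacency matrix. -/
theorem IsPretrained.isBestFactor [Nonempty V] {k : ℕ} {G : Graph V}
    {φ : V → EuclideanSpace ℝ (Fin k)} (hφ : IsPretrained G φ) :
    IsBestFactor (((Fintype.card V : ℝ) ^ 2 / ∑ u, ∑ u', adj G u u') • adj G)
      (Matrix.of fun x i => φ x i) := by
  set N : ℝ := (Fintype.card V : ℝ) with hN
  set S : ℝ := ∑ u, ∑ u', adj G u u' with hS
  have hN0 : 0 < N := by rw [hN]; exact_mod_cast Fintype.card_pos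
  have key : ∀ ψ : V → EuclideanSpace ℝ (Fin k), N ^ 2 * pretrainLoss G ψ =
      frobSq ((Matrix.of fun x i => ψ x i) * (Matrix.of fun x i => ψ x i)ᵀ - (N ^ 2 / S) • adj G)
        - frobSq ((N ^ 2 / S) • adj G) := by
    intro ψ
    simp only [pretrainLoss, frobSq, ← hN, ← hS, Finset.mul_sum, mul_add,
      ← Finset.sum_add_distrib, ← Finset.sum_sub_distrib]
    refine Finset.sum_congr rfl fun x _ => Finset.sum_congr rfl fun y _ => ?_
    have hin : ((Matrix.of fun x i => ψ x i) * (Matrix.of fun x i => ψ x i)ᵀ : Matrix V V ℝ) x y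
        = ⟪ψ x, ψ y⟫ := by
      simp [Matrix.mul_apply, PiLp.inner_apply, mul_comm]
    rw [Matrix.sub_apply, hin, Matrix.smul_apply, smul_eq_mul]
    field_simp
    ring
  intro Y
  have h := mul_le_mul_of_nonneg_left (hφ fun x => WithLp.toLp 2 (Y x)) (sq_nonneg N)
  rw [key, key] at h
  exact (sub_le_sub_iff_right _).1 h

end Loss

/-! ### Spectrum of the mean matrix and the deterministic perturbation bound -/

section BlockModel

variable {r n : ℕ}

/-- The expected adjacency matrix of the stochastic block model. -/
def meanAdj (ρ α β γ : I) : Matrix (Node r n) (Node r n) ℝ :=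
  Matrix.of fun x x' => (edgeProb ρ α β γ s(x, x') : ℝ)

/-- The indicator of equality. -/
def eqInd {J : Type*} [DecidableEq J] (a b : J) : ℝ := if a = b then 1 else 0

theorem sum_eqInd_mul {J : Type*} [DecidableEq J] [Fintype J] (a : J) (f : J → ℝ) :
    ∑ b, eqInd a b * f b = f a := by
  simp [eqInd]

/-- The domains as signs. -/
def domSign (x : Node r n) : ℝ := ![1, -1] (dom x)

/-- The edge probability is a constant, plus a class term, plus a domain term, plus an interaction
on equal class and domain; each acts by summing `v` over the matching nodes. -/
theorem meanAdj_mulVec (ρ α β γ : I) (v : Node r n → ℝ) (x : Node r n) :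
    (meanAdj ρ α β γ *ᵥ v) x = γ * ∑ d, ∑ y, ∑ i, v (d, y, i)
      + (α - γ) * ∑ d, ∑ i, v (d, cls x, i) + (β - γ) * ∑ y, ∑ i, v (dom x, y, i)
      + (ρ - α - β + γ) * ∑ i, v (dom x, cls x, i) := by
  have h1 : ∀ x', meanAdj ρ α β γ x x' * v x' = γ * v x'
      + (α - γ) * (eqInd (cls x) (cls x') * v x')
      + (β - γ) * (eqInd (dom x) (dom x') * v x')
      + (ρ - α - β + γ) * (eqInd (dom x) (dom x') * (eqInd (cls x) (cls x') * v x')) := by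
    intro x'
    simp only [meanAdj, Matrix.of_apply, edgeProb, Sym2.lift_mk, eqInd]
    split_ifs <;> ring
  simp only [mulVec, dotProduct, h1, Finset.sum_add_distrib, ← Finset.mul_sum]
  simp only [Fintype.sum_prod_type, cls, dom, ← Finset.mul_sum, sum_eqInd_mul]

theorem sum_domSign_block (d : Fin 2) (y : Fin r) :
    ∑ i : Fin n, domSign (d, y, i) = n * (![1, -1] d : ℝ) := by
  simp [domSign, dom]

theorem meanAdj_mulVec_domSign (ρ α β γ : I) :
    meanAdj ρ α β γ *ᵥ (domSign : Node r n → ℝ)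
      = (n * (r * (β - γ) + (ρ - α - β + γ)) : ℝ) • domSign := by
  ext x
  rw [meanAdj_mulVec]
  simp only [sum_domSign_block, Fin.sum_univ_two, Finset.sum_const, Finset.card_univ,
    Fintype.card_fin, nsmul_eq_mul, Pi.smul_apply, smul_eq_mul]
  simp only [domSign, Matrix.cons_val_zero, Matrix.cons_val_one]
  ring

theorem domSign_sq (x : Node r n) : domSign x ^ 2 = 1 := by
  rcases x with ⟨d, y, i⟩
  fin_cases d <;> norm_num [domSign, dom]

theorem domSign_dotProduct_self :
    (domSign : Node r n → ℝ) ⬝ᵥ domSign = Fintype.card (Node r n) := by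
  simp only [dotProduct, ← sq, domSign_sq, Finset.sum_const, Finset.card_univ, nsmul_eq_mul,
    mul_one]

/-- The indicators of the classes, and the signs of the domains. -/
def testVector : Option (Fin r) → Node r n → ℝ
  | none => domSign
  | some y => fun x => eqInd y (cls x)

/-- Orthogonality makes all class sums and both domain sums of `v` vanish, so only the interaction
term survives. Its coefficient may be negative, hence the `max`. -/
theorem meanAdj_rayleigh_le (ρ α β γ : I) (v : Node r n → ℝ) (hv : ∀ i, testVector i ⬝ᵥ v = 0) :
    v ⬝ᵥ meanAdj ρ α β γ *ᵥ v ≤ n * max ((ρ : ℝ) - α - β + γ) 0 * (v ⬝ᵥ v) := by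
  set s : Fin 2 → Fin r → ℝ := fun d y => ∑ i, v (d, y, i) with hs
  have h1 : ∀ y, s 0 y + s 1 y = 0 := by
    intro y
    have := hv (some y)
    simpa only [testVector, dotProduct, Fintype.sum_prod_type, cls, ← Finset.mul_sum,
      sum_eqInd_mul, Fin.sum_univ_two] using this
  have h2 : ∑ y, s 0 y - ∑ y, s 1 y = 0 := by
    have := hv none
    simpa [testVector, dotProduct, Fintype.sum_prod_type, dom, domSign,
      ← sub_eq_add_neg] using this
  have h3 : ∑ y, s 0 y + ∑ y, s 1 y = 0 := by
    rw [← Finset.sum_add_distrib]; exact Finset.sum_eq_zero fun y _ => h1 y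
  have h4 : ∀ d, ∑ y, s d y = 0 := by
    intro d; fin_cases d <;> simp <;> linarith
  have hM : ∀ x, (meanAdj ρ α β γ *ᵥ v) x = (ρ - α - β + γ) * s (dom x) (cls x) := by
    intro x
    rw [meanAdj_mulVec]
    change γ * ∑ d, ∑ y, s d y + (α - γ) * ∑ d, s d (cls x) + (β - γ) * ∑ y, s (dom x) y
      + (ρ - α - β + γ) * s (dom x) (cls x) = _
    simp only [h4, Fin.sum_univ_two (f := fun d => s d (cls x)), h1]
    simp
  have hq : v ⬝ᵥ meanAdj ρ α β γ *ᵥ v = (ρ - α - β + γ) * ∑ d, ∑ y, s d y ^ 2 := by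
    simp only [dotProduct, hM, Fintype.sum_prod_type, dom, cls, Finset.mul_sum]
    refine Finset.sum_congr rfl fun d _ => Finset.sum_congr rfl fun y _ => ?_
    rw [← Finset.sum_mul, sq]
    simp only [hs]; ring
  have hcs : ∑ d, ∑ y, s d y ^ 2 ≤ n * (v ⬝ᵥ v) := by
    simp only [dotProduct, Fintype.sum_prod_type, Finset.mul_sum (s := Finset.univ (α := Fin 2)),
      Finset.mul_sum (s := Finset.univ (α := Fin r)), ← sq]
    refine Finset.sum_le_sum fun d _ => Finset.sum_le_sum fun y _ => ?_
    simpa using sq_sum_le_card_mul_sum_sq (s := Finset.univ) (f := fun i => v (d, y, i))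
  have h0 : 0 ≤ ∑ d, ∑ y, s d y ^ 2 := by positivity
  calc v ⬝ᵥ meanAdj ρ α β γ *ᵥ v = (ρ - α - β + γ) * ∑ d, ∑ y, s d y ^ 2 := hq
    _ ≤ max ((ρ : ℝ) - α - β + γ) 0 * ∑ d, ∑ y, s d y ^ 2 := by gcongr; exact le_max_left _ _
    _ ≤ max ((ρ : ℝ) - α - β + γ) 0 * (n * (v ⬝ᵥ v)) := by gcongr
    _ = _ := by ring

/-- A linear predictor of the domain signs yields a linear domain classifier. -/
theorem exists_linearClassifier_loss_le {k : ℕ} (φ : Node r n → EuclideanSpace ℝ (Fin k))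
    (b : Fin k → ℝ) :
    ∃ h : EuclideanSpace ℝ (Fin k) → Fin 2, IsLinearClassifier h ∧
      domainZeroOneLoss h φ ≤
        (∑ x, (domSign x - (φ x).ofLp ⬝ᵥ b) ^ 2) / Fintype.card (Node r n) := by
  -- The second score is 0, so the classifier reads the sign of the predictor. At an error this sign
  -- opposes `domSign` or the predictor is 0, and the squared residual is at least 1.
  refine ⟨linearClassifier (Matrix.of ![b, 0]), ⟨_, rfl⟩, ?_⟩
  rw [domainZeroOneLoss, Finset.sum_div]
  refine Finset.sum_le_sum fun x _ => ?_
  rw [one_div_mul_eq_div]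
  gcongr
  split_ifs with hne
  · have e0 : (Matrix.of ![b, 0] *ᵥ (φ x).ofLp) 0 = (φ x).ofLp ⬝ᵥ b := by
      simp [mulVec, dotProduct_comm]
    have e1 : (Matrix.of ![b, 0] *ᵥ (φ x).ofLp) 1 = 0 := by simp [mulVec]
    rw [linearClassifier, e0, e1] at hne
    rcases x with ⟨d, y, i⟩
    fin_cases d <;> simp [dom, domSign, -one_le_sq_iff_one_le_abs] at hne ⊢ <;> nlinarith
  · positivity

/-- If the deviation of the adjacency matrix from its mean is small in the sense of quadratic
forms, then the domain signs are nearly linear in the pre-trained features. -/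
theorem exists_linearClassifier_loss_le_of_noise {ρ α β γ : I} (hr : 2 ≤ r) (hn : 1 ≤ n) {m : ℝ}
    (hm : 0 < m) (hβγ : m ≤ (β : ℝ) - γ) (hρα : α < ρ)
    {G : Graph (Node r n)}
    (hE : ∀ v, |v ⬝ᵥ (adj G - meanAdj ρ α β γ) *ᵥ v| ≤ n * m / 2 * (v ⬝ᵥ v))
    {φ : Node r n → EuclideanSpace ℝ (Fin (r + 1))} (hφ : IsPretrained G φ) :
    ∃ h : EuclideanSpace ℝ (Fin (r + 1)) → Fin 2, IsLinearClassifier h ∧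
      (n * m / 2) ^ 2 * (Fintype.card (Node r n) * domainZeroOneLoss h φ) ≤
        ((adj G - meanAdj ρ α β γ) *ᵥ domSign) ⬝ᵥ ((adj G - meanAdj ρ α β γ) *ᵥ domSign) := by
  have hn0 : (0 : ℝ) < n := by exact_mod_cast hn
  have hr' : (2 : ℝ) ≤ r := by exact_mod_cast hr
  have hραr : (α : ℝ) < ρ := hρα
  have : Nonempty (Node r n) := ⟨(0, ⟨0, by omega⟩, ⟨0, by omega⟩)⟩
  have hN : (0 : ℝ) < Fintype.card (Node r n) := by exact_mod_cast Fintype.card_pos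
  set A := adj G with hA
  set M : Matrix (Node r n) (Node r n) ℝ := meanAdj ρ α β γ with hM
  set E := A - M with hEdef
  set lam : ℝ := ρ - α - β + γ with hlam
  set μ : ℝ := n * (r * (β - γ) + lam) with hμ
  have hMd : M *ᵥ domSign = μ • domSign := meanAdj_mulVec_domSign ρ α β γ
  have hAE : ∀ v, A *ᵥ v = M *ᵥ v + E *ᵥ v := by
    intro v; rw [hEdef, sub_mulVec]; abel
  -- Here `2 ≤ r` enters: `μ / n - lam = r * (β - γ)`, and `μ / n = (r - 1) * (β - γ) + (ρ - α)`;
  -- both are at least `m`.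
  have hgap : n * max lam 0 + n * m ≤ μ := by
    have h1 : 2 * m ≤ r * (β - γ : ℝ) := by gcongr
    have h2 : m ≤ r * (β - γ : ℝ) + lam := by
      have : m ≤ (r - 1) * (β - γ : ℝ) := by nlinarith
      rw [hlam]; linarith
    rw [hμ, ← mul_add]
    refine mul_le_mul_of_nonneg_left ?_ hn0.le
    rcases max_cases lam 0 with h | h <;> linarith [h.1]
  set S : ℝ := ∑ u, ∑ u', A u u' with hS
  have hAnn : ∀ u u', 0 ≤ A u u' := by
    intro u u'; simp only [hA, adj, Matrix.of_apply]; split_ifs <;> norm_num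
  -- An empty graph would have noise `-μ` in the direction `domSign`, contradicting `hE`.
  have hS0 : 0 < S := by
    refine lt_of_le_of_ne (Finset.sum_nonneg fun _ _ => Finset.sum_nonneg fun _ _ => hAnn _ _) ?_
    intro h0
    have hA0 : A = 0 := by
      ext u u'
      have h1 := (Finset.sum_eq_zero_iff_of_nonneg fun u _ =>
        Finset.sum_nonneg fun u' _ => hAnn u u').1 h0.symm u (Finset.mem_univ _)
      exact (Finset.sum_eq_zero_iff_of_nonneg fun u' _ => hAnn u u').1 h1 u' (Finset.mem_univ _)
    have h1 := (abs_le.1 (hE domSign)).1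
    have h2 : E *ᵥ domSign = -(μ • domSign) := by rw [hEdef, hA0, zero_sub, neg_mulVec, hMd]
    rw [h2, dotProduct_neg, dotProduct_smul, domSign_dotProduct_self, smul_eq_mul] at h1
    have h3 : μ ≤ n * m / 2 := le_of_mul_le_mul_right (by linarith) hN
    have h4 : 0 ≤ n * max lam 0 := mul_nonneg hn0.le (le_max_right _ _)
    have h5 : 0 < n * m := mul_pos hn0 hm
    linarith
  set c : ℝ := (Fintype.card (Node r n) : ℝ) ^ 2 / S with hc
  have hc0 : 0 < c := by positivity
  have hX := hφ.isBestFactor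
  set X : Matrix (Node r n) (Fin (r + 1)) ℝ := Matrix.of fun x i => φ x i with hXdef
  rw [← hA, ← hS, ← hc] at hX
  have hT : (c • A)ᵀ = c • A := by rw [transpose_smul, hA, adj_transpose]
  obtain ⟨b, hb⟩ := exists_transpose_mulVec_sub_eq_zero X domSign
  set u := domSign - X *ᵥ b with hu
  have hray : u ⬝ᵥ A *ᵥ u ≤ (n * max lam 0 + n * m / 2) * (u ⬝ᵥ u) := by
    have h := hX.rayleigh_le_of_forall hT testVector (by simp)
      (B := c * (n * max lam 0 + n * m / 2)) (by positivity) (by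
        intro v hv
        rw [smul_mulVec, dotProduct_smul, smul_eq_mul, mul_assoc, hAE, dotProduct_add]
        gcongr
        have h1 := meanAdj_rayleigh_le ρ α β γ v hv
        have h2 := (abs_le.1 (hE v)).2
        rw [add_mul]
        exact add_le_add h1 h2) hb
    rw [smul_mulVec, dotProduct_smul, smul_eq_mul, mul_assoc] at h
    exact le_of_mul_le_mul_left h hc0
  have huX : ∀ a, u ⬝ᵥ X *ᵥ a = 0 := by
    intro a; rw [dotProduct_mulVec, ← mulVec_transpose, hb, zero_dotProduct]
  have hAX : A * X = X * (c⁻¹ • (Xᵀ * X)) := by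
    have h := hX.mul_eq hT
    rw [Matrix.smul_mul] at h
    rw [Matrix.mul_smul, ← Matrix.mul_assoc, h, smul_smul, inv_mul_cancel₀ hc0.ne', one_smul]
  have hd : domSign = u + X *ᵥ b := by rw [hu]; abel
  have hud : u ⬝ᵥ domSign = u ⬝ᵥ u := by
    conv_lhs => rw [hd, dotProduct_add, huX, add_zero]
  -- By invariance `A` keeps the fitted part `X *ᵥ b` in the column span, which is orthogonal to
  -- `u`.
  have h1 : u ⬝ᵥ A *ᵥ domSign = u ⬝ᵥ A *ᵥ u := by
    conv_lhs => rw [hd, mulVec_add, dotProduct_add, mulVec_mulVec, hAX, ← mulVec_mulVec, huX,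
      add_zero]
  rw [hAE domSign, hMd, dotProduct_add, dotProduct_smul, smul_eq_mul, hud] at h1
  have huu : 0 ≤ u ⬝ᵥ u := by simpa using dotProduct_star_self_nonneg u
  have h2 : n * m / 2 * (u ⬝ᵥ u) ≤ -(u ⬝ᵥ E *ᵥ domSign) := by
    have := mul_le_mul_of_nonneg_right hgap huu
    linarith
  have hcs : (u ⬝ᵥ E *ᵥ domSign) ^ 2 ≤
      (u ⬝ᵥ u) * ((E *ᵥ domSign) ⬝ᵥ (E *ᵥ domSign)) := by
    simp only [dotProduct, ← sq]; exact Finset.sum_mul_sq_le_sq_mul_sq _ _ _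
  have h3 : (n * m / 2) ^ 2 * (u ⬝ᵥ u) ≤ (E *ᵥ domSign) ⬝ᵥ (E *ᵥ domSign) := by
    rcases huu.eq_or_lt with h | h
    · rw [← h, mul_zero]; simpa using dotProduct_star_self_nonneg (E *ᵥ domSign)
    · have h4 : (n * m / 2 * (u ⬝ᵥ u)) ^ 2 ≤ (u ⬝ᵥ E *ᵥ domSign) ^ 2 := by
        rw [← neg_sq (u ⬝ᵥ E *ᵥ domSign)]
        gcongr
      refine le_of_mul_le_mul_left ?_ h
      linarith
  obtain ⟨h, hh, hloss⟩ := exists_linearClassifier_loss_le φ b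
  refine ⟨h, hh, le_trans ?_ h3⟩
  gcongr
  rw [le_div_iff₀ hN, mul_comm] at hloss
  refine hloss.trans (le_of_eq ?_)
  simp only [dotProduct, ← sq]
  rfl

end BlockModel

/-! ### Quadratic forms and the fourth Schatten norm -/

section QuadraticForm

variable {V : Type*} [Fintype V]

theorem frobInner_sq_le (M N : Matrix V V ℝ) : frobInner M N ^ 2 ≤ frobSq M * frobSq N := by
  simp only [frobInner, frobSq, ← Fintype.sum_prod_type']
  exact Finset.sum_mul_sq_le_sq_mul_sq _ _ _

/-- The quadratic form of a symmetric matrix is controlled by the fourth Schatten norm. -/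
theorem abs_rayleigh_le_of_frobSq_sq_le {E : Matrix V V ℝ} (hE : Eᵀ = E) {δ : ℝ} (hδ : 0 ≤ δ)
    (h : frobSq (E * E) ≤ δ ^ 4) (v : V → ℝ) : |v ⬝ᵥ E *ᵥ v| ≤ δ * (v ⬝ᵥ v) := by
  have hvv : 0 ≤ v ⬝ᵥ v := by simpa using dotProduct_star_self_nonneg v
  have h1 : (v ⬝ᵥ E *ᵥ v) ^ 2 ≤ (v ⬝ᵥ v) * ((E *ᵥ v) ⬝ᵥ (E *ᵥ v)) := by
    simp only [dotProduct, ← sq]; exact Finset.sum_mul_sq_le_sq_mul_sq _ _ _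
  -- This form allows a second Cauchy–Schwarz, now for the Frobenius inner product.
  have h2 : (E *ᵥ v) ⬝ᵥ (E *ᵥ v) = frobInner (E * E) (vecMulVec v v) := by
    rw [frobInner_vecMulVec, ← mulVec_mulVec, dotProduct_mulVec v, ← mulVec_transpose, hE]
  have h3 : ((E *ᵥ v) ⬝ᵥ (E *ᵥ v)) ^ 2 ≤ (δ ^ 2 * (v ⬝ᵥ v)) ^ 2 := by
    rw [h2]
    refine (frobInner_sq_le _ _).trans ?_
    rw [frobSq_vecMulVec]
    calc frobSq (E * E) * (v ⬝ᵥ v * v ⬝ᵥ v) ≤ δ ^ 4 * (v ⬝ᵥ v * v ⬝ᵥ v) := by gcongr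
      _ = _ := by ring
  have h4 := abs_le_of_sq_le_sq' h3 (by positivity) |>.2
  refine abs_le_of_sq_le_sq (h1.trans ?_) (by positivity)
  calc (v ⬝ᵥ v) * ((E *ᵥ v) ⬝ᵥ (E *ᵥ v)) ≤ (v ⬝ᵥ v) * (δ ^ 2 * (v ⬝ᵥ v)) := by gcongr
    _ = _ := by ring

end QuadraticForm

/-! ### Independent centered edges -/

section Noise

variable {ι : Type}

/-- The centered indicators of independent edges. -/
def noise (p : ι → I) (e : ι) (G : ι → Bool) : ℝ := (if G e then 1 else 0) - p e

theorem abs_noise_le_one (p : ι → I) (e : ι) (G : ι → Bool) : |noise p e G| ≤ 1 := by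
  have h0 := (p e).2.1
  have h1 := (p e).2.2
  unfold noise
  rw [abs_le]
  split_ifs <;> constructor <;> linarith

variable [Fintype ι]

/-- The product law of independent edges. -/
noncomputable abbrev edgeLaw (p : ι → I) : Measure (ι → Bool) :=
  Measure.pi fun e => bernoulliMeasure true false (p e)

theorem integrable_edgeLaw (p : ι → I) (f : (ι → Bool) → ℝ) : Integrable f (edgeLaw p) :=
  Integrable.of_finite

theorem integral_edgeLaw_le_one (p : ι → I) {f : (ι → Bool) → ℝ} (hf : ∀ G, f G ≤ 1) :
    ∫ G, f G ∂edgeLaw p ≤ 1 := by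
  have := integral_mono (integrable_edgeLaw p f) (integrable_edgeLaw p fun _ => 1) hf
  simpa using this

/-- A product of edge noises in which some edge occurs exactly once has mean zero. -/
theorem integral_prod_noise_eq_zero [DecidableEq ι] (p : ι → I) (s : Multiset ι) (e : ι)
    (he : s.count e = 1) : ∫ G, (s.map fun i => noise p i G).prod ∂edgeLaw p = 0 := by
  let f : ι → Bool → ℝ := fun i b => ((if b then 1 else 0) - (p i : ℝ)) ^ s.count i
  have h1 : ∀ G : ι → Bool, (s.map fun i => noise p i G).prod = ∏ i, f i (G i) := by
    intro G
    rw [Finset.prod_multiset_map_count]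
    refine Finset.prod_subset (Finset.subset_univ _) fun i _ hi => ?_
    rw [Multiset.count_eq_zero_of_notMem (by simpa using hi), pow_zero]
  have h2 : ∫ G : ι → Bool, ∏ i, f i (G i) ∂edgeLaw p
      = ∏ i, ∫ b, f i b ∂bernoulliMeasure true false (p i) :=
    integral_fintype_prod_eq_prod (E := fun _ => Bool) f
  simp only [h1]
  rw [h2]
  refine Finset.prod_eq_zero (Finset.mem_univ e) ?_
  simp only [f, integral_bernoulliMeasure, he]
  simp
  ring

end Noise

/-! ### Moments of the noise matrix -/

section NoiseMatrix

variable {V : Type}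

/-- The centered adjacency matrix of a graph with independent edges. -/
def noiseMatrix (p : Sym2 V → I) (G : Graph V) : Matrix V V ℝ :=
  Matrix.of fun x y => noise p s(x, y) G

theorem noiseMatrix_transpose (p : Sym2 V → I) (G : Graph V) :
    (noiseMatrix p G)ᵀ = noiseMatrix p G := by
  ext x y; simp [noiseMatrix, Sym2.eq_swap]

variable [Fintype V] [DecidableEq V]

theorem integral_noise_mul_noise_le (p : Sym2 V → I) {x z w : V} {a : ℝ} (ha : |a| ≤ 1) :
    ∫ G, a * (noise p s(x, z) G * noise p s(x, w) G) ∂edgeLaw p ≤ if z = w then 1 else 0 := by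
  split_ifs with h
  · refine integral_edgeLaw_le_one p fun G => (le_abs_self _).trans ?_
    rw [abs_mul, abs_mul]
    exact mul_le_one₀ ha (by positivity)
      (mul_le_one₀ (abs_noise_le_one _ _ _) (by positivity) (abs_noise_le_one _ _ _))
  · have h1 := integral_prod_noise_eq_zero p {s(x, z), s(x, w)} s(x, z) (by
      have e : s(x, z) ≠ s(x, w) := by rw [Ne, Sym2.eq_iff]; grind
      simp only [Multiset.insert_eq_cons, Multiset.count_cons, Multiset.count_singleton,
        if_neg e, if_true])
    simp only [Multiset.insert_eq_cons, Multiset.map_cons, Multiset.map_singleton,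
      Multiset.prod_cons, Multiset.prod_singleton] at h1
    rw [integral_const_mul, h1, mul_zero]

/-- The four edges form the closed walk `x, z, y, w, x`. Unless `x = y` or `z = w`, some edge is
used exactly once and the mean vanishes. -/
theorem integral_noise_four_le (p : Sym2 V → I) (x y z w : V) :
    ∫ G, noise p s(x, z) G * (noise p s(z, y) G * (noise p s(x, w) G * noise p s(w, y) G))
      ∂edgeLaw p ≤ (if x = y then 1 else 0) + (if z = w then 1 else 0) := by
  by_cases h : x = y ∨ z = w
  · have h1 : (1 : ℝ) ≤ (if x = y then 1 else 0) + (if z = w then 1 else 0) := by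
      rcases h with h | h <;> rw [if_pos h] <;> split_ifs <;> norm_num
    refine (integral_edgeLaw_le_one p fun G => (le_abs_self _).trans ?_).trans h1
    simp only [abs_mul]
    exact mul_le_one₀ (abs_noise_le_one _ _ _) (by positivity)
      (mul_le_one₀ (abs_noise_le_one _ _ _) (by positivity)
      (mul_le_one₀ (abs_noise_le_one _ _ _) (by positivity) (abs_noise_le_one _ _ _)))
  · push Not at h
    obtain ⟨hxy, hzw⟩ := h
    rw [if_neg hxy, if_neg hzw, add_zero]
    have h1 : ∃ e, Multiset.count e {s(x, z), s(z, y), s(x, w), s(w, y)} = 1 := by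
      -- In this degenerate case `s(x, z)` is used twice, but the loop at `z` only once.
      by_cases hc : x = w ∧ z = y
      · obtain ⟨rfl, rfl⟩ := hc
        refine ⟨s(z, z), ?_⟩
        simp [Multiset.insert_eq_cons, hxy, Ne.symm hxy]
      · refine ⟨s(x, z), ?_⟩
        have e1 : s(x, z) ≠ s(z, y) := by rw [Ne, Sym2.eq_iff]; grind
        have e2 : s(x, z) ≠ s(x, w) := by rw [Ne, Sym2.eq_iff]; grind
        have e3 : s(x, z) ≠ s(w, y) := by rw [Ne, Sym2.eq_iff]; grind
        simp only [Multiset.insert_eq_cons, Multiset.count_cons, Multiset.count_singleton,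
          if_neg e1, if_neg e2, if_neg e3, if_true]
    obtain ⟨e, he⟩ := h1
    have h2 := integral_prod_noise_eq_zero p _ e he
    simp only [Multiset.insert_eq_cons, Multiset.map_cons, Multiset.map_singleton,
      Multiset.prod_cons, Multiset.prod_singleton] at h2
    rw [h2]

theorem integral_noiseMatrix_mulVec_le (p : Sym2 V → I) {d : V → ℝ} (hd : ∀ x, |d x| ≤ 1) :
    ∫ G, (noiseMatrix p G *ᵥ d) ⬝ᵥ (noiseMatrix p G *ᵥ d) ∂edgeLaw p
      ≤ (Fintype.card V : ℝ) ^ 2 := by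
  have h1 : ∀ G, (noiseMatrix p G *ᵥ d) ⬝ᵥ (noiseMatrix p G *ᵥ d)
      = ∑ x, ∑ z, ∑ w, d z * d w * (noise p s(x, z) G * noise p s(x, w) G) := by
    intro G
    simp only [dotProduct, mulVec, noiseMatrix, Matrix.of_apply, Finset.sum_mul_sum]
    exact Finset.sum_congr rfl fun x _ => Finset.sum_congr rfl fun z _ =>
      Finset.sum_congr rfl fun w _ => by ring
  simp only [h1]
  rw [integral_finsetSum _ fun x _ => integrable_edgeLaw p _]
  calc _ ≤ ∑ x : V, ∑ z : V, ∑ w : V, (if z = w then 1 else 0 : ℝ) := by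
        refine Finset.sum_le_sum fun x _ => ?_
        rw [integral_finsetSum _ fun x _ => integrable_edgeLaw p _]
        refine Finset.sum_le_sum fun z _ => ?_
        rw [integral_finsetSum _ fun x _ => integrable_edgeLaw p _]
        refine Finset.sum_le_sum fun w _ => integral_noise_mul_noise_le p ?_
        rw [abs_mul]
        exact mul_le_one₀ (hd z) (by positivity) (hd w)
    _ = _ := by simp [sq]

theorem integral_frobSq_noiseMatrix_sq_le (p : Sym2 V → I) :
    ∫ G, frobSq (noiseMatrix p G * noiseMatrix p G) ∂edgeLaw p
      ≤ 2 * (Fintype.card V : ℝ) ^ 3 := by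
  have h1 : ∀ G, frobSq (noiseMatrix p G * noiseMatrix p G)
      = ∑ x, ∑ y, ∑ z, ∑ w, noise p s(x, z) G * (noise p s(z, y) G *
          (noise p s(x, w) G * noise p s(w, y) G)) := by
    intro G
    simp only [frobSq, Matrix.mul_apply, noiseMatrix, Matrix.of_apply, sq, Finset.sum_mul_sum]
    exact Finset.sum_congr rfl fun x _ => Finset.sum_congr rfl fun z _ =>
      Finset.sum_congr rfl fun w _ => Finset.sum_congr rfl fun w _ => by ring
  simp only [h1]
  rw [integral_finsetSum _ fun x _ => integrable_edgeLaw p _]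
  calc _ ≤ ∑ x : V, ∑ y : V, ∑ z : V, ∑ w : V,
          ((if x = y then 1 else 0) + (if z = w then 1 else 0) : ℝ) := by
        refine Finset.sum_le_sum fun x _ => ?_
        rw [integral_finsetSum _ fun x _ => integrable_edgeLaw p _]
        refine Finset.sum_le_sum fun y _ => ?_
        rw [integral_finsetSum _ fun x _ => integrable_edgeLaw p _]
        refine Finset.sum_le_sum fun z _ => ?_
        rw [integral_finsetSum _ fun x _ => integrable_edgeLaw p _]
        exact Finset.sum_le_sum fun w _ => integral_noise_four_le p x y z w
    _ = _ := by
        simp [Finset.sum_add_distrib]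
        ring

/-- With high probability, the noise is small on a given sign vector and in fourth Schatten
norm. -/
theorem edgeLaw_real_noise_small [Nonempty V] (p : Sym2 V → I) {d : V → ℝ}
    (hd : ∀ x, |d x| ≤ 1) :
    0.999 ≤ (edgeLaw p).real {G |
      (noiseMatrix p G *ᵥ d) ⬝ᵥ (noiseMatrix p G *ᵥ d) ≤ 3000 * (Fintype.card V : ℝ) ^ 2 ∧
      frobSq (noiseMatrix p G * noiseMatrix p G) ≤ 3000 * (Fintype.card V : ℝ) ^ 3} := by
  set N : ℝ := (Fintype.card V : ℝ) with hN
  have hN0 : 0 < N := by rw [hN]; exact_mod_cast Fintype.card_pos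
  set f : Graph V → ℝ := fun G => (noiseMatrix p G *ᵥ d) ⬝ᵥ (noiseMatrix p G *ᵥ d)
  set g : Graph V → ℝ := fun G => frobSq (noiseMatrix p G * noiseMatrix p G)
  have hf : ∀ G, 0 ≤ f G := fun G => by
    simpa using dotProduct_star_self_nonneg (noiseMatrix p G *ᵥ d)
  have hg : ∀ G, 0 ≤ g G := fun G => frobSq_nonneg _
  -- One application of Markov to the normalized sum treats both events: mean at most 3 against
  -- threshold 3000 leaves failure probability 0.001.
  have hint : ∫ G, (f G / N ^ 2 + g G / N ^ 3) ∂edgeLaw p ≤ 3 := by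
    rw [integral_add (integrable_edgeLaw p _) (integrable_edgeLaw p _), integral_div, integral_div]
    have h1 : (∫ G, f G ∂edgeLaw p) / N ^ 2 ≤ 1 :=
      (div_le_one (by positivity)).2 (integral_noiseMatrix_mulVec_le p hd)
    have h2 : (∫ G, g G ∂edgeLaw p) / N ^ 3 ≤ 2 :=
      (div_le_iff₀ (by positivity)).2 (integral_frobSq_noiseMatrix_sq_le p)
    linarith
  have hmarkov := mul_meas_ge_le_integral_of_nonneg (μ := edgeLaw p)
    (f := fun G => f G / N ^ 2 + g G / N ^ 3)
    (Filter.Eventually.of_forall fun G => by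
      have := hf G; have := hg G; simp only [Pi.zero_apply]; positivity)
    (integrable_edgeLaw p _) 3000
  have hcompl := probReal_compl_eq_one_sub (μ := edgeLaw p)
    (Set.toFinite {G | 3000 ≤ f G / N ^ 2 + g G / N ^ 3}).measurableSet
  have hsub : {G | 3000 ≤ f G / N ^ 2 + g G / N ^ 3}ᶜ
      ⊆ {G | f G ≤ 3000 * N ^ 2 ∧ g G ≤ 3000 * N ^ 3} := by
    intro G hG
    simp only [Set.mem_compl_iff, Set.mem_ofPred_eq, not_le] at hG
    have h1 : 0 ≤ f G / N ^ 2 := div_nonneg (hf G) (by positivity)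
    have h2 : 0 ≤ g G / N ^ 3 := div_nonneg (hg G) (by positivity)
    exact ⟨(div_le_iff₀ (by positivity)).1 (by linarith),
      (div_le_iff₀ (by positivity)).1 (by linarith)⟩
  have := measureReal_mono (μ := edgeLaw p) hsub
  norm_num at *
  linarith

end NoiseMatrix

/-! ### Combination of the bounds -/

theorem domainZeroOneLoss_le_one {r n k : ℕ} (h : EuclideanSpace ℝ (Fin k) → Fin 2)
    (φ : Node r n → EuclideanSpace ℝ (Fin k)) : domainZeroOneLoss h φ ≤ 1 := by
  calc domainZeroOneLoss h φ ≤ ∑ x : Node r n, 1 / (Fintype.card (Node r n) : ℝ) := by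
        refine Finset.sum_le_sum fun x _ => mul_le_of_le_one_right (by positivity) ?_
        split_ifs <;> norm_num
    _ = Fintype.card (Node r n) / (Fintype.card (Node r n) : ℝ) := by
        rw [Finset.sum_const, Finset.card_univ, nsmul_eq_mul, mul_one_div]
    _ ≤ 1 := div_self_le_one _

end ContrastiveSBM

theorem mainTheorem2 :
    ∃ c > (0 : ℝ), ∃ C > (0 : ℝ), ∃ p : Polynomial ℝ,
      ∀ (r n : ℕ) (ρ α β γ : unitInterval),
        2 ≤ r → max α β < ρ → γ < min α β →
        c * ((r : ℝ) / min ((α : ℝ) - γ) ((β : ℝ) - γ) ^ 2) ≤ (n : ℝ) →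
        0.999 ≤ (ContrastiveSBM.sbm r n ρ α β γ).real
          {G | ∀ φ : ContrastiveSBM.Node r n → EuclideanSpace ℝ (Fin (r + 1)),
            ContrastiveSBM.IsPretrained G φ →
            ∃ h : EuclideanSpace ℝ (Fin (r + 1)) → Fin 2,
              ContrastiveSBM.IsLinearClassifier h ∧
              ContrastiveSBM.domainZeroOneLoss h φ ≤
                C * (1 / (min ((α : ℝ) - γ) ((β : ℝ) - γ) ^ 6 * (n : ℝ))) *
                  p.eval (r : ℝ)} := by
  -- The value `c = 1` serves only to force `0 < n`. The constant is `3000 * 2 ^ 3 * 2 ^ 4`, from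
  -- `3000 * (2 * r * n) ^ 3 ≤ (n * m / 2) ^ 4`.
  refine ⟨1, one_pos, 384000, by norm_num, Polynomial.X ^ 3, ?_⟩
  intro r n ρ α β γ hr hρ hγ hn
  have hαρ : α < ρ := (le_max_left _ _).trans_lt hρ
  have hγα : (γ : ℝ) < α := hγ.trans_le (min_le_left _ _)
  have hγβ : (γ : ℝ) < β := hγ.trans_le (min_le_right _ _)
  set m : ℝ := min ((α : ℝ) - γ) ((β : ℝ) - γ) with hm
  have hm0 : 0 < m := lt_min (sub_pos.2 hγα) (sub_pos.2 hγβ)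
  have hm1 : m ≤ 1 := (min_le_left _ _).trans (by linarith [α.2.2, γ.2.1])
  have hr0 : (0 : ℝ) < r := by exact_mod_cast (by omega : 0 < r)
  have hr1 : (1 : ℝ) ≤ r := by exact_mod_cast (by omega : 1 ≤ r)
  have hn0 : (0 : ℝ) < n := lt_of_lt_of_le (by positivity) hn
  have hn1 : 1 ≤ n := by exact_mod_cast hn0
  simp only [Polynomial.eval_pow, Polynomial.eval_X]
  -- In this range the claimed bound is at least 1 and holds for every graph; otherwise `n` is large
  -- enough for the noise to fit in half the gap.
  by_cases hbig : m ^ 6 * n ≤ 384000 * (r : ℝ) ^ 3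
  · have hset : {G : ContrastiveSBM.Graph (ContrastiveSBM.Node r n) |
        ∀ φ : ContrastiveSBM.Node r n → EuclideanSpace ℝ (Fin (r + 1)),
          ContrastiveSBM.IsPretrained G φ →
          ∃ h : EuclideanSpace ℝ (Fin (r + 1)) → Fin 2,
            ContrastiveSBM.IsLinearClassifier h ∧
            ContrastiveSBM.domainZeroOneLoss h φ ≤
              384000 * (1 / (m ^ 6 * (n : ℝ))) * (r : ℝ) ^ 3} = Set.univ := by
      refine Set.eq_univ_of_forall fun G φ _ => ⟨_, ⟨0, rfl⟩,
        (ContrastiveSBM.domainZeroOneLoss_le_one _ φ).trans ?_⟩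
      rw [mul_one_div, div_mul_eq_mul_div, le_div_iff₀ (by positivity), one_mul]
      exact hbig
    rw [hset, probReal_univ]
    norm_num
  · push Not at hbig
    have : Nonempty (ContrastiveSBM.Node r n) := ⟨(0, ⟨0, by omega⟩, ⟨0, by omega⟩)⟩
    have hcard : (Fintype.card (ContrastiveSBM.Node r n) : ℝ) = 2 * r * n := by
      simp [mul_assoc]
    refine (ContrastiveSBM.edgeLaw_real_noise_small (ContrastiveSBM.edgeProb ρ α β γ)
      (d := ContrastiveSBM.domSign (r := r) (n := n)) fun x => ?_).trans
      (measureReal_mono ?_)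
    · exact (sq_le_one_iff_abs_le_one _).1 (ContrastiveSBM.domSign_sq x).le
    · rintro G ⟨hG1, hG2⟩ φ hφ
      have hE : ContrastiveSBM.noiseMatrix (ContrastiveSBM.edgeProb ρ α β γ) G
          = ContrastiveSBM.adj G - ContrastiveSBM.meanAdj ρ α β γ := rfl
      have hsmall : 3000 * (2 * r * n : ℝ) ^ 3 ≤ (n * m / 2) ^ 4 := by
        have h1 : m ^ 6 * n ≤ m ^ 4 * n := by
          gcongr ?_ * _
          exact pow_le_pow_of_le_one hm0.le hm1 (by norm_num)
        have h2 := mul_le_mul_of_nonneg_right (hbig.le.trans h1) (pow_pos hn0 3).le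
        calc 3000 * (2 * r * n : ℝ) ^ 3 = 384000 * (r : ℝ) ^ 3 * n ^ 3 / 16 := by ring
          _ ≤ m ^ 4 * n * n ^ 3 / 16 := by gcongr
          _ = _ := by ring
      rw [hcard] at hG1 hG2
      obtain ⟨h, hh, hloss⟩ := ContrastiveSBM.exists_linearClassifier_loss_le_of_noise hr hn1 hm0
        (min_le_right _ _) hαρ (fun v => ContrastiveSBM.abs_rayleigh_le_of_frobSq_sq_le
          (by rw [← hE, ContrastiveSBM.noiseMatrix_transpose]) (by positivity)
          (by rw [← hE]; exact hG2.trans hsmall) v) hφ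
      refine ⟨h, hh, ?_⟩
      rw [← hE, hcard] at hloss
      have h1 := hloss.trans hG1
      -- This is the sharper rate `24000 * r / (m ^ 2 * n)`; it is then weakened using `m ≤ 1` and
      -- `1 ≤ r`.
      have h2 : ContrastiveSBM.domainZeroOneLoss h φ * (m ^ 2 * n) ≤ 24000 * r := by
        refine le_of_mul_le_mul_left ?_ (by positivity : (0 : ℝ) < r * n ^ 2 / 2)
        linarith
      rw [mul_one_div, div_mul_eq_mul_div, le_div_iff₀ (by positivity)]
      calc ContrastiveSBM.domainZeroOneLoss h φ * (m ^ 6 * n)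
          = m ^ 4 * (ContrastiveSBM.domainZeroOneLoss h φ * (m ^ 2 * n)) := by ring
        _ ≤ m ^ 4 * (24000 * r) := by gcongr
        _ ≤ 1 * (24000 * r) := by gcongr; exact pow_le_one₀ hm0.le hm1
        _ ≤ 384000 * (r : ℝ) ^ 3 := by
          have : (r : ℝ) ≤ r ^ 3 := le_self_pow₀ hr1 (by norm_num)
          linarith
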